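/- Let $\mathbb F$ be a field. For an $m\times n$ pencil $A+\lambda B$ over $\mathbb F$, the minimal ranks $\rho(A,B)=(r,s)$ are $$s=\min_{(t,u)\ne 0}\operatorname{rank}(tA+uB),\qquad r=\min_{(t',u')\notin\operatorname{span}\{(t^\star,u^\star)\}}\operatorname{rank}(t'A+u'B),$$ where $(t^\star,u^\star)\in\mathbb F^2\setminus\{0\}$ is any minimizer in the definition of $s$ (the value of $r$ does not depend on its choice). Let $H_v$ be the $v\times v$ matrix with ones on the superdiagonal and zeros elsewhere, $E$ the identity matrix, $J_d(a)=aE+H_d$, and $N_v(\lambda)=E+\lambda H_v$. Let $L_k(\lambda)$ be the $k\times(k+1)$ pencil with entries $\lambda$ at the positions $(i,i)$, entries $1$ at the positions $(i,i+1)$ and zeros elsewhere, and let $R_l(\lambda)=L_l(\lambda)^{\mathsf T}$. Let $A+\lambda B$ be an arbitrary $m\times n$ pencil over $\mathbb F$ with Kronecker canonical form $S(\lambda)\oplus(A'+\lambda B')$; that is, for some invertible $P,U$ over $\mathbb F$, $P(A+\lambda B)U^{\mathsf T}=S(\lambda)\oplus(A'+\lambda B')$, where the singular part is $$S(\lambda)=L_{k_1}(\lambda)\oplus\dots\oplus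 L_{k_p}(\lambda)\oplus R_{l_1}(\lambda)\oplus\dots\oplus R_{l_{p'}}(\lambda)$$ with minimal column indices $k_1,\dots,k_p\ge 0$ and minimal row indices $l_1,\dots,l_{p'}\ge 0$, and the regular part, of size $n'\times n'$, is $$A'+\lambda B'=\big[N_{v_1}(\lambda)\oplus\dots\oplus N_{v_j}(\lambda)\big]\oplus\big[(J_{d_1}(a_1)\oplus\dots\oplus J_{d_k}(a_k)\oplus Q)+\lambda E\big]$$ with $v_i,d_i\ge 1$, $a_i\in\mathbb F$, and $Q$ a square matrix over $\mathbb F$ such that no elementary divisor of $Q+\lambda E$ over $\mathbb F$ is a power of a linear form. (Any of these groups of blocks may be empty.) Put $\bar s=k_1+\dots+k_p+l_1+\dots+l_{p'}$. For $a\in\mathbb F$ let $c(a)$ be the number of indices $i$ with $a_i=a$. Let $k_s=c(a^\star)$ be the largest value of $c$ on $\mathbb F$, and let $k_r=c(a^{\star\star})$ be the largest value of $c$ on $\mathbb F\setminus\{a^\star\}$. Let $k'_s\ge k'_r$ be the first and second largest components (with multiplicity) of the triple $(j,k_s,k_r)$. Then $$\rho(A',B')=(n'-k'_r,\;n'-k'_s)\qquad\text{and}\qquad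 \rho(A,B)=\rho(A',B')+(\bar s,\bar s).$$ -/

import Mathlib

open Matrix Polynomial

/-- A matrix pencil `A + λ B` over `F`, given by its coefficients `A = const` and `B = lin`. -/
structure MatrixPencil (F m n : Type*) where
  const : Matrix m n F
  lin : Matrix m n F

namespace MatrixPencil

/-- The linear combination `t A + u B`, with `x = (t, u)`. -/
def comb {F m n : Type*} [Field F] (L : MatrixPencil F m n) (x : F × F) : Matrix m n F :=
  x.1 • L.const + x.2 • L.lin

/-- `x` attains the minimum of `rank (t A + u B)` over all `(t, u) ≠ 0`. -/
def IsMinimizer {F m n : Type*} [Field F] [Fintype n]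
    (L : MatrixPencil F m n) (x : F × F) : Prop :=
  x ≠ 0 ∧ ∀ y : F × F, y ≠ 0 → (L.comb x).rank ≤ (L.comb y).rank

/-- `ρ(L) = (r, s)`: the number `s` is the minimum of `rank (t A + u B)` over `(t, u) ≠ 0` and,
whichever minimizer `x` is picked, `r` is the minimum of `rank (t' A + u' B)` over all `(t', u')`
outside the line spanned by `x`. -/
def HasMinRanks {F m n : Type*} [Field F] [Fintype n]
    (L : MatrixPencil F m n) (r s : ℕ) : Prop :=
  IsLeast {k : ℕ | ∃ x : F × F, x ≠ 0 ∧ (L.comb x).rank = k} s ∧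
  ∀ x : F × F, L.IsMinimizer x →
    IsLeast {k : ℕ | ∃ y : F × F, y ∉ Submodule.span F {x} ∧ (L.comb y).rank = k} r

/-- The minimal ranks of a pencil are unique. -/
theorem HasMinRanks.unique {F m n : Type*} [Field F] [Fintype n] {L : MatrixPencil F m n}
    {r s r' s' : ℕ} (h : L.HasMinRanks r s) (h' : L.HasMinRanks r' s') : r = r' ∧ s = s' := by
  obtain ⟨x, hx, hxs⟩ := h.1.1
  have hm : L.IsMinimizer x := ⟨hx, fun y hy => hxs ▸ h.1.2 ⟨y, hy, rfl⟩⟩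
  exact ⟨(h.2 x hm).unique (h'.2 x hm), h.1.unique h'.1⟩

/-- The transposed pencil. -/
def transpose {F m n : Type*} (L : MatrixPencil F m n) : MatrixPencil F n m :=
  ⟨L.constᵀ, L.linᵀ⟩

/-- The direct sum `L ⊕ M` (block diagonal). -/
def directSum {F m n m' n' : Type*} [Field F]
    (L : MatrixPencil F m n) (M : MatrixPencil F m' n') : MatrixPencil F (m ⊕ m') (n ⊕ n') :=
  ⟨Matrix.fromBlocks L.const 0 0 M.const, Matrix.fromBlocks L.lin 0 0 M.lin⟩

/-- The direct sum of a finite family of pencils (block diagonal). -/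
def blockSum {F : Type*} [Field F] {p : ℕ} {m n : Fin p → Type*}
    (L : ∀ i, MatrixPencil F (m i) (n i)) : MatrixPencil F (Σ i, m i) (Σ i, n i) :=
  ⟨Matrix.blockDiagonal' fun i => (L i).const, Matrix.blockDiagonal' fun i => (L i).lin⟩

/-- The matrix `H_v`, with ones on the superdiagonal and zeros elsewhere. -/
def shift (F : Type*) [Field F] (v : ℕ) : Matrix (Fin v) (Fin v) F :=
  Matrix.of fun i j => if (j : ℕ) = (i : ℕ) + 1 then 1 else 0

/-- `L_k(λ)`, the `k × (k+1)` pencil with `λ` at `(i, i)` and `1` at `(i, i + 1)`. -/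
def colBlock (F : Type*) [Field F] (k : ℕ) : MatrixPencil F (Fin k) (Fin (k + 1)) :=
  ⟨Matrix.of fun i j => if (j : ℕ) = (i : ℕ) + 1 then 1 else 0,
   Matrix.of fun i j => if (j : ℕ) = (i : ℕ) then 1 else 0⟩

/-- `R_l(λ)`, the `(l+1) × l` transpose of `L_l(λ)`. -/
def rowBlock (F : Type*) [Field F] (l : ℕ) : MatrixPencil F (Fin (l + 1)) (Fin l) :=
  (colBlock F l).transpose

/-- `N_v(λ) = E + λ H_v`, the block of an infinite elementary divisor. -/
def infBlock (F : Type*) [Field F] (v : ℕ) : MatrixPencil F (Fin v) (Fin v) :=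
  ⟨1, shift F v⟩

/-- `J_d(a) + λ E` with `J_d(a) = a E + H_d`, the block of the elementary divisor `(a + λ)^d`. -/
def jordanBlock {F : Type*} [Field F] (d : ℕ) (a : F) : MatrixPencil F (Fin d) (Fin d) :=
  ⟨a • (1 : Matrix (Fin d) (Fin d) F) + shift F d, 1⟩

/-- The pencil `A + λ B` as a matrix of polynomials in `λ`. -/
noncomputable def toPolyMatrix {F m n : Type*} [Field F] (L : MatrixPencil F m n) :
    Matrix m n F[X] :=
  L.const.map C + (X : F[X]) • L.lin.map C

end MatrixPencil

/-- `f` is an elementary divisor of the square polynomial matrix `M`: it is a positive power of a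
monic irreducible polynomial, and the cyclic module `F[λ] / (f)` is a direct summand of the
cokernel of `M`. -/
def IsElementaryDivisor {F : Type*} [Field F] {q : ℕ} (M : Matrix (Fin q) (Fin q) F[X])
    (f : F[X]) : Prop :=
  (∃ (g : F[X]) (e : ℕ), g.Monic ∧ Irreducible g ∧ 0 < e ∧ f = g ^ e) ∧
  ∃ N N' : Submodule F[X] ((Fin q → F[X]) ⧸ LinearMap.range M.mulVecLin),
    IsCompl N N' ∧ Nonempty (N ≃ₗ[F[X]] (F[X] ⧸ Ideal.span {f}))

/-- A Kronecker canonical form over `F`: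
`[⨁ L_{k_i}] ⊕ [⨁ R_{l_i}] ⊕ ([⨁ N_{v_i}] ⊕ [⨁ (J_{d_i}(a_i) + λ E)] ⊕ [Q + λ E])`,
where no elementary divisor of `Q + λ E` is a power of a linear form. -/
structure KroneckerForm (F : Type*) [Field F] where
  /-- number of minimal column indices -/
  numCol : ℕ
  /-- minimal column indices -/
  k : Fin numCol → ℕ
  /-- number of minimal row indices -/
  numRow : ℕ
  /-- minimal row indices -/
  l : Fin numRow → ℕ
  /-- number of blocks with an infinite elementary divisor -/
  j : ℕ
  /-- sizes of these blocks -/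
  v : Fin j → ℕ
  v_pos : ∀ i, 0 < v i
  /-- number of Jordan blocks -/
  numJordan : ℕ
  /-- sizes of the Jordan blocks -/
  d : Fin numJordan → ℕ
  d_pos : ∀ i, 0 < d i
  /-- the elementary divisor of the `i`-th Jordan block is `(a i + λ) ^ (d i)` -/
  a : Fin numJordan → F
  /-- size of `Q` -/
  q : ℕ
  Q : Matrix (Fin q) (Fin q) F
  Q_nonlinear : ∀ f : F[X], IsElementaryDivisor (MatrixPencil.mk Q 1).toPolyMatrix f →
    ¬ ∃ (b : F) (e : ℕ), f = (C b + X) ^ e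

namespace KroneckerForm

variable {F : Type*} [Field F] (K : KroneckerForm F)

/-- Row indices of the singular part. -/
abbrev SingRow : Type := (Σ i, Fin (K.k i)) ⊕ (Σ i, Fin (K.l i + 1))

/-- Column indices of the singular part. -/
abbrev SingCol : Type := (Σ i, Fin (K.k i + 1)) ⊕ (Σ i, Fin (K.l i))

/-- Row and column indices of the regular part. -/
abbrev Reg : Type := (Σ i, Fin (K.v i)) ⊕ ((Σ i, Fin (K.d i)) ⊕ Fin K.q)

/-- The singular part `S(λ)`. -/
def singularPart : MatrixPencil F K.SingRow K.SingCol :=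
  (MatrixPencil.blockSum fun i => MatrixPencil.colBlock F (K.k i)).directSum
    (MatrixPencil.blockSum fun i => MatrixPencil.rowBlock F (K.l i))

/-- The regular part `A' + λ B'`. -/
def regularPart : MatrixPencil F K.Reg K.Reg :=
  (MatrixPencil.blockSum fun i => MatrixPencil.infBlock F (K.v i)).directSum
    ((MatrixPencil.blockSum fun i => MatrixPencil.jordanBlock (K.d i) (K.a i)).directSum
      ⟨K.Q, 1⟩)

/-- The whole canonical pencil `S(λ) ⊕ (A' + λ B')`. -/
def pencil : MatrixPencil F (K.SingRow ⊕ K.Reg) (K.SingCol ⊕ K.Reg) :=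
  K.singularPart.directSum K.regularPart

/-- The sum of all minimal indices. -/
def indexSum : ℕ := ∑ i, K.k i + ∑ i, K.l i

/-- The size of the regular part. -/
def regDim : ℕ := ∑ i, K.v i + ∑ i, K.d i + K.q

open Classical in
/-- The number of Jordan blocks whose elementary divisor is a power of `c + λ`. -/
noncomputable def count (c : F) : ℕ := (Finset.univ.filter fun i => K.a i = c).card

end KroneckerForm

/-- `K` is a Kronecker canonical form of the `m × n` pencil `L = A + λ B`: some
`(P, U) ∈ GL_m(F) × GL_n(F)` transforms `L` into `P A Uᵀ + λ P B Uᵀ`, which is the pencil of `K`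
(up to numbering the rows and columns of the latter by `1, …, m` and `1, …, n`). -/
def HasKroneckerForm {F : Type*} [Field F] {m n : ℕ}
    (L : MatrixPencil F (Fin m) (Fin n)) (K : KroneckerForm F) : Prop :=
  ∃ (eRow : K.SingRow ⊕ K.Reg ≃ Fin m) (eCol : K.SingCol ⊕ K.Reg ≃ Fin n)
    (P : GL (Fin m) F) (U : GL (Fin n) F),
    P.1 * L.const * U.1ᵀ = Matrix.reindex eRow eCol K.pencil.const ∧
    P.1 * L.lin * U.1ᵀ = Matrix.reindex eRow eCol K.pencil.lin

/-- The largest component of a triple. -/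
def firstLargest (x y z : ℕ) : ℕ := max x (max y z)

/-- The second largest component (with multiplicity) of a triple. -/
def secondLargest (x y z : ℕ) : ℕ := max (min x y) (max (min x z) (min y z))

/-! For `x ≠ 0`, the blocks `L_k`, `R_l` and `Q + λ E` have full rank at `x = (t, u)`, whereas a
block `N_v` loses rank one exactly if `t = 0` and `J_d(a) + λ E` exactly if `t a + u = 0`. Hence
`rank (t A' + u B')` is `n'` minus the number of blocks that are singular at `x`. This number
depends only on the line through `x`: it is `j` on the line of `(0, 1)` and `c(a)` on the line of
`(1, -a)`, so the minimal ranks correspond to the two largest of these numbers.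

That `Q + c E` is invertible is seen on the cokernel of `Q + λ E`, a torsion module: unless
`λ - c` acts surjectively on it, it has a cyclic summand that is primary for `λ - c`. If `λ - c`
does act surjectively, the substitution `λ = c` shows that `Q + c E` is onto. -/

section BlockRank

theorem rank_add_finrank_ker_mulVecLin {F m n : Type*} [Field F] [Fintype n] (A : Matrix m n F) :
    A.rank + Module.finrank F (LinearMap.ker A.mulVecLin) = Fintype.card n := by
  rw [Matrix.rank, LinearMap.finrank_range_add_finrank_ker, Module.finrank_fintype_fun_eq_card]

theorem card_le_rank_of_det_submatrix_ne_zero {F m n k : Type*} [Field F] [Fintype n] [Fintype k]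
    [DecidableEq k] {A : Matrix m n F} (row : k → m) (col : k → n)
    (h : (A.submatrix row col).det ≠ 0) : Fintype.card k ≤ A.rank :=
  rank_of_det_ne_zero h ▸ A.rank_submatrix_le row col

/-- The kernel of a block diagonal matrix with two blocks is the product of their kernels. -/
def kerFromBlocksEquiv {R m n m' n' : Type*} [CommSemiring R] [Fintype n] [Fintype n']
    (A : Matrix m n R) (D : Matrix m' n' R) :
    LinearMap.ker (fromBlocks A 0 0 D).mulVecLin ≃ₗ[R]
      LinearMap.ker A.mulVecLin × LinearMap.ker D.mulVecLin where
  toFun x :=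
    have h : Sum.elim (A *ᵥ (x.1 ∘ Sum.inl)) (D *ᵥ (x.1 ∘ Sum.inr)) = 0 := by
      simpa only [LinearMap.mem_ker, mulVecLin_apply, fromBlocks_mulVec, zero_mulVec, add_zero,
        zero_add] using x.2
    (⟨x.1 ∘ Sum.inl, funext fun i => congrFun h (Sum.inl i)⟩,
      ⟨x.1 ∘ Sum.inr, funext fun i => congrFun h (Sum.inr i)⟩)
  map_add' _ _ := rfl
  map_smul' _ _ := rfl
  invFun y := ⟨Sum.elim y.1.1 y.2.1, by
      have h₁ : A *ᵥ y.1.1 = 0 := y.1.2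
      have h₂ : D *ᵥ y.2.1 = 0 := y.2.2
      ext (i | i) <;> simp [fromBlocks_mulVec, h₁, h₂]⟩
  left_inv x := by ext (i | i) <;> rfl
  right_inv _ := rfl

theorem rank_fromBlocks_diagonal {F m n m' n' : Type*} [Field F] [Fintype n] [Fintype n']
    (A : Matrix m n F) (D : Matrix m' n' F) :
    (fromBlocks A 0 0 D).rank = A.rank + D.rank := by
  have h := rank_add_finrank_ker_mulVecLin (fromBlocks A 0 0 D)
  rw [(kerFromBlocksEquiv A D).finrank_eq, Module.finrank_prod, Fintype.card_sum,
    ← rank_add_finrank_ker_mulVecLin A, ← rank_add_finrank_ker_mulVecLin D] at h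
  omega

variable {ι : Type*} [Fintype ι] [DecidableEq ι] {m n : ι → Type*} [∀ i, Fintype (n i)]

theorem blockDiagonal'_mulVec_apply {R : Type*} [NonUnitalNonAssocSemiring R]
    (A : ∀ i, Matrix (m i) (n i) R) (x : (Σ i, n i) → R) (i : ι) (a : m i) :
    (blockDiagonal' A *ᵥ x) ⟨i, a⟩ = (A i *ᵥ fun b => x ⟨i, b⟩) a := by
  simp only [mulVec, dotProduct, Fintype.sum_sigma]
  rw [Finset.sum_eq_single i]
  · simp only [blockDiagonal'_apply_eq]
  · intro k _ hk
    simp only [blockDiagonal'_apply_ne A _ _ hk.symm, zero_mul, Finset.sum_const_zero]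
  · simp only [Finset.mem_univ, not_true_eq_false, IsEmpty.forall_iff]

/-- The kernel of a block diagonal matrix is the product of the kernels of its blocks. -/
def kerBlockDiagonal'Equiv {R : Type*} [CommSemiring R] (A : ∀ i, Matrix (m i) (n i) R) :
    LinearMap.ker (blockDiagonal' A).mulVecLin ≃ₗ[R] ∀ i, LinearMap.ker (A i).mulVecLin where
  toFun x i := ⟨fun b => x.1 ⟨i, b⟩, by
    ext a
    rw [mulVecLin_apply, ← blockDiagonal'_mulVec_apply]
    exact congrFun x.2 ⟨i, a⟩⟩
  map_add' _ _ := rfl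
  map_smul' _ _ := rfl
  invFun y := ⟨fun b => (y b.1).1 b.2, by
    ext ⟨i, a⟩
    rw [mulVecLin_apply, blockDiagonal'_mulVec_apply]
    exact congrFun (y i).2 a⟩
  left_inv _ := rfl
  right_inv _ := rfl

theorem rank_blockDiagonal' {F : Type*} [Field F] (A : ∀ i, Matrix (m i) (n i) F) :
    (blockDiagonal' A).rank = ∑ i, (A i).rank := by
  have h := rank_add_finrank_ker_mulVecLin (blockDiagonal' A)
  rw [(kerBlockDiagonal'Equiv A).finrank_eq, Module.finrank_pi_fintype, Fintype.card_sigma,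
    ← Finset.sum_congr rfl fun i _ => rank_add_finrank_ker_mulVecLin (A i),
    Finset.sum_add_distrib] at h
  exact Nat.add_right_cancel h

end BlockRank

section TorsionModule

theorem isCompl_range_ker_of_comp_eq_id {R M N : Type*} [Ring R] [AddCommGroup M] [Module R M]
    [AddCommGroup N] [Module R N] {f : M →ₗ[R] N} {g : N →ₗ[R] M} (h : f ∘ₗ g = LinearMap.id) :
    IsCompl (LinearMap.range g) (LinearMap.ker f) := by
  have hproj : LinearMap.IsProj (LinearMap.range g) (g ∘ₗ f) := by
    refine ⟨fun x => ⟨f x, rfl⟩, ?_⟩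
    rintro _ ⟨y, rfl⟩
    exact congrArg g (LinearMap.congr_fun h y)
  rw [← LinearMap.ker_comp_of_ker_eq_bot f
    (LinearMap.ker_eq_bot.2 (LinearMap.injective_of_comp_eq_id g f h))]
  exact hproj.isCompl

theorem exists_isCompl_of_equiv_directSum {R M ι : Type*} [Ring R] [AddCommGroup M]
    [Module R M] {N : ι → Type*} [∀ i, AddCommGroup (N i)] [∀ i, Module R (N i)]
    (e : M ≃ₗ[R] DirectSum ι N) (i : ι) :
    ∃ P P' : Submodule R M, IsCompl P P' ∧ Nonempty (P ≃ₗ[R] N i) := by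
  classical
  have h : (DirectSum.component R ι N i ∘ₗ e.toLinearMap) ∘ₗ
      (e.symm.toLinearMap ∘ₗ DirectSum.lof R ι N i) = LinearMap.id := by
    ext x
    simp [DirectSum.component.lof_self]
  exact ⟨_, _, isCompl_range_ker_of_comp_eq_id h,
    ⟨(LinearEquiv.ofInjective _ (LinearMap.injective_of_comp_eq_id _ _ h)).symm⟩⟩

theorem surjective_smul_quotient_span_of_isCoprime {R : Type*} [CommRing R] {g a : R}
    (h : IsCoprime g a) : Function.Surjective fun x : R ⧸ Ideal.span {a} => g • x := by
  obtain ⟨u, v, huv⟩ := h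
  intro y
  obtain ⟨y, rfl⟩ := Ideal.Quotient.mk_surjective y
  refine ⟨Ideal.Quotient.mk _ (u * y), ?_⟩
  refine (Ideal.Quotient.eq (x := g * (u * y))).2 (Ideal.mem_span_singleton'.2 ⟨-(v * y), ?_⟩)
  linear_combination (-y) * huv

theorem associated_of_not_isCoprime_pow {R : Type*} [CommRing R] [IsDomain R]
    [IsPrincipalIdealRing R] {g p : R} (hg : Irreducible g) (hp : Irreducible p) {e : ℕ}
    (h : ¬ IsCoprime g (p ^ e)) : 0 < e ∧ Associated p g := by
  have hdvd : g ∣ p ^ e := by rwa [hg.coprime_iff_not_dvd, not_not] at h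
  refine ⟨Nat.pos_of_ne_zero fun he => hg.not_isUnit ?_, ?_⟩
  · rwa [he, pow_zero, ← isUnit_iff_dvd_one] at hdvd
  · exact (hg.associated_of_dvd hp (hg.prime.dvd_of_dvd_pow hdvd)).symm

theorem exists_primary_summand_of_not_surjective_smul {R M : Type*} [CommRing R] [IsDomain R]
    [IsPrincipalIdealRing R] [AddCommGroup M] [Module R M] [Module.Finite R M]
    (hM : Module.IsTorsion R M) {g : R} (hg : Irreducible g)
    (hsurj : ¬ Function.Surjective fun x : M => g • x) :
    ∃ e : ℕ, 0 < e ∧ ∃ P P' : Submodule R M,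
      IsCompl P P' ∧ Nonempty (P ≃ₗ[R] (R ⧸ Ideal.span {g ^ e})) := by
  obtain ⟨ι, _, p, hp, e, ⟨φ⟩⟩ := Module.equiv_directSum_of_isTorsion hM
  obtain ⟨i, hi⟩ : ∃ i, ¬ IsCoprime g (p i ^ e i) := by
    by_contra! hcop
    have hsum := DirectSum.lmap_surjective (fun i => LinearMap.lsmul R (R ⧸ R ∙ p i ^ e i) g)
      |>.2 fun i => surjective_smul_quotient_span_of_isCoprime (hcop i)
    refine hsurj fun x => ?_
    obtain ⟨z, hz⟩ := hsum (φ x)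
    refine ⟨φ.symm z, φ.injective ?_⟩
    rw [map_smul, φ.apply_symm_apply, ← hz]
    rfl
  obtain ⟨he, hpg⟩ := associated_of_not_isCoprime_pow hg (hp i) hi
  obtain ⟨P, P', hc, ⟨ψ⟩⟩ := exists_isCompl_of_equiv_directSum φ i
  exact ⟨e i, he, P, P', hc, ⟨ψ.trans (Submodule.quotEquivOfEq _ _
    (Ideal.span_singleton_eq_span_singleton.2 hpg.pow_pow))⟩⟩

end TorsionModule

section Cokernel

theorem isTorsion_quotient_range_mulVecLin {R n : Type*} [CommRing R] [Fintype n] [DecidableEq n]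
    {M : Matrix n n R} (hM : M.det ∈ nonZeroDivisors R) :
    Module.IsTorsion R ((n → R) ⧸ LinearMap.range M.mulVecLin) := by
  intro x
  obtain ⟨x, rfl⟩ := Submodule.Quotient.mk_surjective _ x
  refine ⟨⟨M.det, hM⟩, ?_⟩
  refine (Submodule.Quotient.mk_eq_zero _).2 ⟨M.adjugate *ᵥ x, ?_⟩
  rw [mulVecLin_apply, mulVec_mulVec, mul_adjugate, smul_mulVec, one_mulVec]

theorem surjective_mulVec_map_of_surjective_smul {R S m n : Type*} [CommRing R] [CommRing S]
    [Fintype n] (M : Matrix m n R) {φ : R →+* S} (hφ : Function.Surjective φ) {g : R}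
    (hg : φ g = 0)
    (h : Function.Surjective fun x : (m → R) ⧸ LinearMap.range M.mulVecLin => g • x) :
    Function.Surjective (M.map φ).mulVec := by
  intro w
  obtain ⟨w, rfl⟩ := hφ.comp_left w
  obtain ⟨x, hx⟩ := h (Submodule.Quotient.mk w)
  obtain ⟨x, rfl⟩ := Submodule.Quotient.mk_surjective _ x
  obtain ⟨y, hy⟩ := (Submodule.Quotient.eq _).1 hx
  refine ⟨φ ∘ (-y), funext fun i => ?_⟩
  have hyi : (M *ᵥ y) i = g * x i - w i := congrFun hy i
  rw [← RingHom.map_mulVec, mulVec_neg, Pi.neg_apply, hyi]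
  simp [hg]

end Cokernel

section Span

variable {F V : Type*} [DivisionRing F] [AddCommGroup V] [Module F V]

theorem notMem_span_singleton_symm {x y : V}
    (hy : y ≠ 0) (h : x ∉ Submodule.span F {y}) : y ∉ Submodule.span F {x} := by
  intro hyx
  obtain ⟨c, rfl⟩ := Submodule.mem_span_singleton.1 hyx
  have hc : IsUnit c := isUnit_iff_ne_zero.2 fun hc => hy (by rw [hc, zero_smul])
  exact h (Submodule.span_singleton_smul_eq hc x ▸ Submodule.mem_span_singleton_self x)

theorem ne_zero_of_notMem_span {x y : V}
    (h : y ∉ Submodule.span F {x}) : y ≠ 0 :=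
  fun hy => h (hy ▸ Submodule.zero_mem _)

theorem exists_eq_smul_zero_one_or_one_neg {F : Type*} [Field F] {x : F × F} (hx : x ≠ 0) :
    ∃ t : F, t ≠ 0 ∧ (x = t • (0, 1) ∨ ∃ a : F, x = t • (1, -a)) := by
  by_cases ht : x.1 = 0
  · exact ⟨x.2, fun hu => hx (Prod.ext ht hu), Or.inl (by ext <;> simp [ht])⟩
  · exact ⟨x.1, ht, Or.inr ⟨-(x.2 / x.1), by ext <;> simp [mul_div_cancel₀ _ ht]⟩⟩

end Span

namespace MatrixPencil

variable {F : Type*} [Field F]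

section MinRanks

variable {m n : Type*} [Fintype n]

/-- If a minimizer `x` lies off the line of `x₁`, then the ranks at `x`, `x₁` and `x₂` agree. -/
theorem IsMinimizer.hasMinRanks {L : MatrixPencil F m n} {x₁ x₂ : F × F} (h₁ : L.IsMinimizer x₁)
    (hx₂ : x₂ ∉ Submodule.span F {x₁})
    (h₂ : ∀ y ∉ Submodule.span F {x₁}, (L.comb x₂).rank ≤ (L.comb y).rank) :
    L.HasMinRanks (L.comb x₂).rank (L.comb x₁).rank := by
  refine ⟨⟨⟨x₁, h₁.1, rfl⟩, ?_⟩, fun x hx => ?_⟩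
  · rintro _ ⟨y, hy, rfl⟩
    exact h₁.2 y hy
  by_cases hxx₁ : x ∈ Submodule.span F {x₁}
  · have hspan : Submodule.span F {x} = Submodule.span F {x₁} := by
      refine le_antisymm ((Submodule.span_singleton_le_iff_mem _ _).2 hxx₁)
        ((Submodule.span_singleton_le_iff_mem _ _).2 ?_)
      by_contra h
      exact notMem_span_singleton_symm hx.1 h hxx₁
    rw [hspan]
    refine ⟨⟨x₂, hx₂, rfl⟩, ?_⟩
    rintro _ ⟨y, hy, rfl⟩
    exact h₂ y hy
  · have hle : (L.comb x₂).rank ≤ (L.comb x₁).rank := (h₂ x hxx₁).trans (hx.2 x₁ h₁.1)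
    have hge : (L.comb x₁).rank ≤ (L.comb x₂).rank := h₁.2 x₂ (ne_zero_of_notMem_span hx₂)
    refine ⟨⟨x₁, notMem_span_singleton_symm h₁.1 hxx₁, le_antisymm hge hle⟩, ?_⟩
    rintro _ ⟨y, hy, rfl⟩
    exact hle.trans (h₁.2 y (ne_zero_of_notMem_span hy))

theorem HasMinRanks.add_right {m' n' : Type*} [Fintype n'] {L : MatrixPencil F m n}
    {M : MatrixPencil F m' n'} {r s c : ℕ} (hM : M.HasMinRanks r s)
    (hL : ∀ x : F × F, x ≠ 0 → (L.comb x).rank = (M.comb x).rank + c) :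
    L.HasMinRanks (r + c) (s + c) := by
  obtain ⟨⟨⟨x₁, hx₁, hs⟩, hs_le⟩, hr⟩ := hM
  refine ⟨⟨⟨x₁, hx₁, by rw [hL x₁ hx₁, hs]⟩, ?_⟩, fun x hx => ?_⟩
  · rintro _ ⟨y, hy, rfl⟩
    rw [hL y hy]
    exact Nat.add_le_add_right (hs_le ⟨y, hy, rfl⟩) c
  · have hxM : M.IsMinimizer x := ⟨hx.1, fun y hy => by
      simpa only [hL x hx.1, hL y hy, Nat.add_le_add_iff_right] using hx.2 y hy⟩
    obtain ⟨⟨x₂, hx₂, hr_eq⟩, hr_le⟩ := hr x hxM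
    refine ⟨⟨x₂, hx₂, by rw [hL x₂ (ne_zero_of_notMem_span hx₂), hr_eq]⟩, ?_⟩
    rintro _ ⟨y, hy, rfl⟩
    rw [hL y (ne_zero_of_notMem_span hy)]
    exact Nat.add_le_add_right (hr_le ⟨y, hy, rfl⟩) c

end MinRanks

section RankComb

theorem rank_comb_directSum {m n m' n' : Type*} [Fintype n] [Fintype n']
    (L : MatrixPencil F m n) (M : MatrixPencil F m' n') (x : F × F) :
    ((L.directSum M).comb x).rank = (L.comb x).rank + (M.comb x).rank := by
  rw [← rank_fromBlocks_diagonal]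
  simp [comb, directSum, fromBlocks_smul, fromBlocks_add]

theorem rank_comb_blockSum {p : ℕ} {m n : Fin p → Type*} [∀ i, Fintype (n i)]
    (L : ∀ i, MatrixPencil F (m i) (n i)) (x : F × F) :
    ((blockSum L).comb x).rank = ∑ i, ((L i).comb x).rank := by
  rw [← rank_blockDiagonal']
  simp only [comb, blockSum, ← blockDiagonal'_smul, ← blockDiagonal'_add]
  rfl

theorem comb_transpose {m n : Type*} (L : MatrixPencil F m n) (x : F × F) :
    L.transpose.comb x = (L.comb x)ᵀ := by
  simp only [comb, transpose, transpose_add, transpose_smul]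

theorem comb_smul {m n : Type*} (L : MatrixPencil F m n) (c : F) (x : F × F) :
    L.comb (c • x) = c • L.comb x := by
  simp only [comb, Prod.smul_fst, Prod.smul_snd, smul_eq_mul, mul_smul, smul_add]

theorem rank_comb_smul {m n : Type*} [Fintype n] (L : MatrixPencil F m n) {c : F} (hc : c ≠ 0)
    (x : F × F) : (L.comb (c • x)).rank = (L.comb x).rank := by
  rw [comb_smul, rank_smul_of_mem_nonZeroDivisors _ (mem_nonZeroDivisors_of_ne_zero hc)]

theorem rank_comb_eq_of_mul_eq_reindex {m n m' n' : Type*} [Fintype m] [DecidableEq m]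
    [Fintype n] [DecidableEq n] [Fintype n'] {L : MatrixPencil F m n} {M : MatrixPencil F m' n'}
    (eRow : m' ≃ m) (eCol : n' ≃ n) (P : GL m F) (U : GL n F)
    (hconst : P.1 * L.const * U.1ᵀ = reindex eRow eCol M.const)
    (hlin : P.1 * L.lin * U.1ᵀ = reindex eRow eCol M.lin) (x : F × F) :
    (L.comb x).rank = (M.comb x).rank := by
  have h : P.1 * L.comb x * U.1ᵀ = reindex eRow eCol (M.comb x) := by
    simp only [comb, Matrix.mul_add, Matrix.add_mul, Matrix.mul_smul, Matrix.smul_mul, hconst,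
      hlin]
    rfl
  have hP : IsUnit P.1.det := (isUnit_iff_isUnit_det _).1 P.isUnit
  have hU : IsUnit U.1ᵀ.det := by
    rw [det_transpose]
    exact (isUnit_iff_isUnit_det _).1 U.isUnit
  rw [← rank_reindex eRow eCol (M.comb x), ← h, rank_mul_eq_left_of_isUnit_det _ _ hU,
    rank_mul_eq_right_of_isUnit_det _ _ hP]

theorem det_smul_one_add_smul_shift (v : ℕ) (b c : F) :
    (b • (1 : Matrix (Fin v) (Fin v) F) + c • shift F v).det = b ^ v := by
  rw [det_of_isUpperTriangular]
  · simp [shift]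
  · intro i j (hij : (j : ℕ) < i)
    simp [shift, Fin.ext_iff, hij.ne', show (j : ℕ) ≠ i + 1 by omega]

theorem rank_shift_succ (v : ℕ) : (shift F (v + 1)).rank = v := by
  apply le_antisymm
  · refine (rank_le_card_of_support_subset _ (Finset.univ.erase (Fin.last v)) ?_).trans (by simp)
    rw [Function.support_subset_iff']
    intro i hi
    obtain rfl : i = Fin.last v := by simpa using hi
    ext j
    simp [shift, j.isLt.ne]
  · have hminor : (shift F (v + 1)).submatrix Fin.castSucc Fin.succ = 1 := by
      ext i j
      simp [shift, Matrix.one_apply, Fin.ext_iff, eq_comm]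
    simpa using card_le_rank_of_det_submatrix_ne_zero (A := shift F (v + 1)) Fin.castSucc Fin.succ
      (by simp [hminor])

theorem rank_smul_one_add_smul_shift [DecidableEq F] {v : ℕ} (hv : 0 < v) {b c : F}
    (hbc : b = 0 → c ≠ 0) :
    (b • (1 : Matrix (Fin v) (Fin v) F) + c • shift F v).rank + (if b = 0 then 1 else 0) = v := by
  split_ifs with hb
  · obtain ⟨w, rfl⟩ := Nat.exists_eq_succ_of_ne_zero hv.ne'
    rw [hb, zero_smul, zero_add,
      rank_smul_of_mem_nonZeroDivisors _ (mem_nonZeroDivisors_of_ne_zero (hbc hb)),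
      rank_shift_succ]
  · rw [rank_of_det_ne_zero (by rw [det_smul_one_add_smul_shift]; exact pow_ne_zero _ hb),
      Fintype.card_fin, add_zero]

theorem rank_comb_infBlock [DecidableEq F] {v : ℕ} (hv : 0 < v) {x : F × F} (hx : x ≠ 0) :
    ((infBlock F v).comb x).rank + (if x.1 = 0 then 1 else 0) = v :=
  rank_smul_one_add_smul_shift hv fun ht hu => hx (Prod.ext ht hu)

theorem comb_jordanBlock (d : ℕ) (a : F) (x : F × F) :
    (jordanBlock d a).comb x =
      (x.1 * a + x.2) • (1 : Matrix (Fin d) (Fin d) F) + x.1 • shift F d := by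
  simp only [comb, jordanBlock]
  module

theorem rank_comb_jordanBlock [DecidableEq F] {d : ℕ} (hd : 0 < d) (a : F) {x : F × F}
    (hx : x ≠ 0) :
    ((jordanBlock d a).comb x).rank + (if x.1 * a + x.2 = 0 then 1 else 0) = d := by
  rw [comb_jordanBlock]
  exact rank_smul_one_add_smul_shift hd fun h ht => hx (Prod.ext ht (by simpa [ht] using h))

theorem comb_colBlock_submatrix_castSucc (k : ℕ) (x : F × F) :
    ((colBlock F k).comb x).submatrix id Fin.castSucc = x.2 • 1 + x.1 • shift F k := by
  ext i j
  simp [comb, colBlock, shift, Matrix.one_apply, Fin.ext_iff, eq_comm, add_comm]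

theorem comb_colBlock_submatrix_succ (k : ℕ) (x : F × F) :
    ((colBlock F k).comb x).submatrix id Fin.succ = (x.1 • 1 + x.2 • shift F k)ᵀ := by
  ext i j
  simp [comb, colBlock, shift, Matrix.one_apply, Fin.ext_iff, eq_comm]

theorem rank_comb_colBlock (k : ℕ) {x : F × F} (hx : x ≠ 0) :
    ((colBlock F k).comb x).rank = k := by
  refine le_antisymm (by simpa using ((colBlock F k).comb x).rank_le_card_height) ?_
  by_cases hu : x.2 = 0
  · have ht : x.1 ≠ 0 := fun ht => hx (Prod.ext ht hu)
    simpa using card_le_rank_of_det_submatrix_ne_zero (A := (colBlock F k).comb x) id Fin.succ (by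
      rw [comb_colBlock_submatrix_succ, det_transpose, det_smul_one_add_smul_shift]
      exact pow_ne_zero _ ht)
  · simpa using card_le_rank_of_det_submatrix_ne_zero (A := (colBlock F k).comb x) id
      Fin.castSucc (by
        rw [comb_colBlock_submatrix_castSucc, det_smul_one_add_smul_shift]
        exact pow_ne_zero _ hu)

theorem rank_comb_rowBlock (l : ℕ) {x : F × F} (hx : x ≠ 0) :
    ((rowBlock F l).comb x).rank = l := by
  rw [rowBlock, comb_transpose, rank_transpose, rank_comb_colBlock l hx]

end RankComb

section ElementaryDivisors

variable {q : ℕ} {Q : Matrix (Fin q) (Fin q) F}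

theorem toPolyMatrix_one_eq_charmatrix {n : Type*} [Fintype n] [DecidableEq n]
    (A : Matrix n n F) : (MatrixPencil.mk A 1).toPolyMatrix = (-A).charmatrix := by
  ext i j : 2
  by_cases h : i = j <;> simp [toPolyMatrix, charmatrix, h, add_comm]

theorem toPolyMatrix_map_eval {m n : Type*} (L : MatrixPencil F m n) (c : F) :
    L.toPolyMatrix.map (evalRingHom c) = L.comb (1, c) := by
  ext i j
  simp [toPolyMatrix, comb, mul_comm c]

theorem isUnit_comb_one_of_no_linear_elementaryDivisor
    (hQ : ∀ f : F[X], IsElementaryDivisor (MatrixPencil.mk Q 1).toPolyMatrix f →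
      ¬ ∃ (b : F) (e : ℕ), f = (C b + X) ^ e) (c : F) :
    IsUnit ((MatrixPencil.mk Q 1).comb (1, c)) := by
  rw [← mulVec_surjective_iff_isUnit, ← toPolyMatrix_map_eval]
  have heq : C (-c) + X = X - C c := by rw [C_neg, neg_add_eq_sub]
  refine surjective_mulVec_map_of_surjective_smul _ (eval_surjective c) (g := X - C c)
    (by simp) ?_
  by_contra hsurj
  have htors := isTorsion_quotient_range_mulVecLin (M := (MatrixPencil.mk Q 1).toPolyMatrix) (by
    rw [toPolyMatrix_one_eq_charmatrix]
    exact (-Q).charpoly_monic.mem_nonZeroDivisors)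
  obtain ⟨e, he, hsummand⟩ :=
    exists_primary_summand_of_not_surjective_smul htors (irreducible_X_sub_C c) hsurj
  exact hQ _ ⟨⟨_, e, monic_X_sub_C c, irreducible_X_sub_C c, he, rfl⟩, hsummand⟩
    ⟨-c, e, by rw [heq]⟩

theorem rank_comb_of_no_linear_elementaryDivisor
    (hQ : ∀ f : F[X], IsElementaryDivisor (MatrixPencil.mk Q 1).toPolyMatrix f →
      ¬ ∃ (b : F) (e : ℕ), f = (C b + X) ^ e) {x : F × F} (hx : x ≠ 0) :
    ((MatrixPencil.mk Q 1).comb x).rank = q := by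
  obtain ⟨t, ht, rfl | ⟨a, rfl⟩⟩ := exists_eq_smul_zero_one_or_one_neg hx
  · rw [rank_comb_smul _ ht]
    simp [comb]
  · rw [rank_comb_smul _ ht, rank_of_isUnit _ (isUnit_comb_one_of_no_linear_elementaryDivisor hQ _),
      Fintype.card_fin]

end ElementaryDivisors

end MatrixPencil

namespace KroneckerForm

variable {F : Type*} [Field F] (K : KroneckerForm F)

open Classical in
/-- The geometric multiplicity of the point `x = (t, u)` as an eigenvalue of the regular part:
the number of blocks that become singular in `t A' + u B'`. For `x ≠ 0` these are all the blocks
`N_v` if `t = 0`, and the blocks `J_d(a) + λ E` with `t a + u = 0`. -/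
noncomputable def geomMultiplicity (x : F × F) : ℕ :=
  (if x.1 = 0 then K.j else 0) + (Finset.univ.filter fun i => x.1 * K.a i + x.2 = 0).card

theorem geomMultiplicity_smul {c : F} (hc : c ≠ 0) (x : F × F) :
    K.geomMultiplicity (c • x) = K.geomMultiplicity x := by
  classical
  have h (i) : c * x.1 * K.a i + c * x.2 = 0 ↔ x.1 * K.a i + x.2 = 0 := by
    rw [mul_assoc, ← mul_add, mul_eq_zero, or_iff_right hc]
  simp only [geomMultiplicity, Prod.smul_fst, Prod.smul_snd, smul_eq_mul, mul_eq_zero, hc,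
    false_or]
  rw [Finset.filter_congr fun i _ => h i]

theorem geomMultiplicity_zero_one : K.geomMultiplicity (0, 1) = K.j := by
  simp [geomMultiplicity]

theorem geomMultiplicity_one_neg (c : F) : K.geomMultiplicity (1, -c) = K.count c := by
  classical
  have h (i) : 1 * K.a i + -c = 0 ↔ K.a i = c := by rw [one_mul, add_neg_eq_zero]
  simp only [geomMultiplicity, count, one_ne_zero, if_false, zero_add]
  rw [Finset.filter_congr fun i _ => h i]

theorem geomMultiplicity_cases {x : F × F} (hx : x ≠ 0) :
    (x ∈ Submodule.span F {((0, 1) : F × F)} ∧ K.geomMultiplicity x = K.j) ∨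
      ∃ c : F, x ∈ Submodule.span F {((1, -c) : F × F)} ∧ K.geomMultiplicity x = K.count c := by
  obtain ⟨t, ht, rfl | ⟨c, rfl⟩⟩ := exists_eq_smul_zero_one_or_one_neg hx
  · exact Or.inl ⟨Submodule.mem_span_singleton.2 ⟨t, rfl⟩,
      by rw [K.geomMultiplicity_smul ht, geomMultiplicity_zero_one]⟩
  · exact Or.inr ⟨c, Submodule.mem_span_singleton.2 ⟨t, rfl⟩,
      by rw [K.geomMultiplicity_smul ht, geomMultiplicity_one_neg]⟩

theorem rank_comb_regularPart_add_geomMultiplicity {x : F × F} (hx : x ≠ 0) :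
    (K.regularPart.comb x).rank + K.geomMultiplicity x = K.regDim := by
  classical
  have hinf : ∑ i, ((MatrixPencil.infBlock F (K.v i)).comb x).rank + (if x.1 = 0 then K.j else 0) =
      ∑ i, K.v i := by
    simp [← fun i => MatrixPencil.rank_comb_infBlock (K.v_pos i) hx, Finset.sum_add_distrib]
  have hjordan : ∑ i, ((MatrixPencil.jordanBlock (K.d i) (K.a i)).comb x).rank +
      (Finset.univ.filter fun i => x.1 * K.a i + x.2 = 0).card = ∑ i, K.d i := by
    rw [Finset.card_filter, ← Finset.sum_add_distrib]
    exact Finset.sum_congr rfl fun i _ => MatrixPencil.rank_comb_jordanBlock (K.d_pos i) _ hx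
  simp only [regularPart, MatrixPencil.rank_comb_directSum, MatrixPencil.rank_comb_blockSum,
    MatrixPencil.rank_comb_of_no_linear_elementaryDivisor K.Q_nonlinear hx, geomMultiplicity,
    regDim, ← hinf, ← hjordan]
  ring

theorem rank_comb_singularPart {x : F × F} (hx : x ≠ 0) :
    (K.singularPart.comb x).rank = K.indexSum := by
  simp only [singularPart, MatrixPencil.rank_comb_directSum, MatrixPencil.rank_comb_blockSum,
    MatrixPencil.rank_comb_colBlock _ hx, MatrixPencil.rank_comb_rowBlock _ hx, indexSum]

/-- Which of the three distinguished lines carry `x₁` and `x₂` depends on the position of `K.j`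
relative to `K.count a₁` and `K.count a₂`. -/
theorem exists_largest_geomMultiplicity {a₁ a₂ : F} (ha₁ : ∀ c : F, K.count c ≤ K.count a₁)
    (ha₂ : a₂ ≠ a₁) (ha₂' : ∀ c : F, c ≠ a₁ → K.count c ≤ K.count a₂) :
    ∃ x₁ x₂ : F × F, x₁ ≠ 0 ∧ x₂ ∉ Submodule.span F {x₁} ∧
      K.geomMultiplicity x₁ = firstLargest K.j (K.count a₁) (K.count a₂) ∧
      K.geomMultiplicity x₂ = secondLargest K.j (K.count a₁) (K.count a₂) ∧
      (∀ y ≠ 0, K.geomMultiplicity y ≤ K.geomMultiplicity x₁) ∧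
      ∀ y ∉ Submodule.span F {x₁}, K.geomMultiplicity y ≤ K.geomMultiplicity x₂ := by
  have h₂₁ : K.count a₂ ≤ K.count a₁ := ha₁ a₂
  have hle {y : F × F} (hy : y ≠ 0) : K.geomMultiplicity y ≤ max K.j (K.count a₁) := by
    rcases K.geomMultiplicity_cases hy with ⟨-, h⟩ | ⟨c, -, h⟩
    · exact h.trans_le (le_max_left _ _)
    · exact h.trans_le ((ha₁ c).trans (le_max_right _ _))
  have hle_of_notMem_a₁ {y : F × F} (hy : y ∉ Submodule.span F {((1, -a₁) : F × F)}) :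
      K.geomMultiplicity y ≤ max K.j (K.count a₂) := by
    rcases K.geomMultiplicity_cases (ne_zero_of_notMem_span hy) with ⟨-, h⟩ | ⟨c, hc, h⟩
    · exact h.trans_le (le_max_left _ _)
    · exact h.trans_le ((ha₂' c (by rintro rfl; exact hy hc)).trans (le_max_right _ _))
  rcases le_total (K.count a₁) K.j with hj₁ | hj₁
  · refine ⟨(0, 1), (1, -a₁), by simp, by simp [Submodule.mem_span_singleton], ?_⟩
    simp only [geomMultiplicity_zero_one, geomMultiplicity_one_neg, firstLargest, secondLargest]
    refine ⟨by omega, by omega, fun y hy => (hle hy).trans_eq (max_eq_left hj₁), fun y hy => ?_⟩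
    rcases K.geomMultiplicity_cases (ne_zero_of_notMem_span hy) with ⟨h, -⟩ | ⟨c, -, h⟩
    · exact absurd h hy
    · exact h.trans_le (ha₁ c)
  rcases le_total (K.count a₂) K.j with hj₂ | hj₂
  · refine ⟨(1, -a₁), (0, 1), by simp, by simp [Submodule.mem_span_singleton], ?_⟩
    simp only [geomMultiplicity_zero_one, geomMultiplicity_one_neg, firstLargest, secondLargest]
    exact ⟨by omega, by omega, fun y hy => (hle hy).trans_eq (max_eq_right hj₁),
      fun y hy => (hle_of_notMem_a₁ hy).trans_eq (max_eq_left hj₂)⟩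
  · refine ⟨(1, -a₁), (1, -a₂), by simp, by simp [Submodule.mem_span_singleton, ha₂.symm], ?_⟩
    simp only [geomMultiplicity_one_neg, firstLargest, secondLargest]
    exact ⟨by omega, by omega, fun y hy => (hle hy).trans_eq (max_eq_right hj₁),
      fun y hy => (hle_of_notMem_a₁ hy).trans_eq (max_eq_right hj₂)⟩

end KroneckerForm

theorem HasKroneckerForm.rank_comb {F : Type*} [Field F] {m n : ℕ}
    {L : MatrixPencil F (Fin m) (Fin n)} {K : KroneckerForm F} (hK : HasKroneckerForm L K)
    {x : F × F} (hx : x ≠ 0) :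
    (L.comb x).rank = (K.regularPart.comb x).rank + K.indexSum := by
  obtain ⟨eRow, eCol, P, U, hconst, hlin⟩ := hK
  rw [MatrixPencil.rank_comb_eq_of_mul_eq_reindex eRow eCol P U hconst hlin,
    KroneckerForm.pencil, MatrixPencil.rank_comb_directSum, K.rank_comb_singularPart hx, add_comm]

theorem mainTheorem4 {F : Type*} [Field F] {m n : ℕ} (A B : Matrix (Fin m) (Fin n) F)
    (K : KroneckerForm F) (hK : HasKroneckerForm (MatrixPencil.mk A B) K)
    -- `k_s = count a₁` is the largest number of Jordan blocks sharing a factor `a₁ + λ`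
    (a₁ : F) (ha₁ : ∀ c : F, K.count c ≤ K.count a₁)
    -- `k_r = count a₂` is the second largest one, with `a₂ ≠ a₁`
    (a₂ : F) (ha₂ : a₂ ≠ a₁) (ha₂' : ∀ c : F, c ≠ a₁ → K.count c ≤ K.count a₂) :
    ∃ r' s' : ℕ,
      r' + secondLargest K.j (K.count a₁) (K.count a₂) = K.regDim ∧
      s' + firstLargest K.j (K.count a₁) (K.count a₂) = K.regDim ∧
      K.regularPart.HasMinRanks r' s' ∧
      (MatrixPencil.mk A B).HasMinRanks (r' + K.indexSum) (s' + K.indexSum) := by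
  obtain ⟨x₁, x₂, hx₁, hx₂, hμ₁, hμ₂, hmax₁, hmax₂⟩ :=
    K.exists_largest_geomMultiplicity ha₁ ha₂ ha₂'
  have hrank {x : F × F} (hx : x ≠ 0) := K.rank_comb_regularPart_add_geomMultiplicity hx
  have hrank_le {x y : F × F} (hx : x ≠ 0) (hy : y ≠ 0)
      (h : K.geomMultiplicity y ≤ K.geomMultiplicity x) :
      (K.regularPart.comb x).rank ≤ (K.regularPart.comb y).rank := by
    have := hrank hx
    have := hrank hy
    omega
  have hx₂0 : x₂ ≠ 0 := ne_zero_of_notMem_span hx₂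
  have hmin : K.regularPart.IsMinimizer x₁ := ⟨hx₁, fun y hy => hrank_le hx₁ hy (hmax₁ y hy)⟩
  have hreg := hmin.hasMinRanks hx₂ fun y hy =>
    hrank_le hx₂0 (ne_zero_of_notMem_span hy) (hmax₂ y hy)
  exact ⟨_, _, hμ₂ ▸ hrank hx₂0, hμ₁ ▸ hrank hx₁, hreg, hreg.add_right fun _ => hK.rank_comb⟩
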